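/- Reidemeister spectrum of finite abelian 2-groups. For a group $G$ and an endomorphism $\varphi$ of $G$, let $R(\varphi)$ be the number (possibly $\infty$) of classes of the equivalence relation "$x = z\,y\,\varphi(z)^{-1}$ for some $z \in G$" on $G$, and let $\mathrm{Spec}_R(G) = \{R(\psi) \mid \psi \in \mathrm{Aut}(G)\}$. Let $n \geq 0$ and let $e = (e_1, \ldots, e_n)$ be integers with $1 \leq e_1 \leq e_2 \leq \cdots \leq e_n$. Decompose $e$ into blocks as follows. Step 1: each maximal constant subsequence of $e_1, \ldots, e_n$ of length at least $2$ forms one $a$-block. Step 2: among the remaining entries, going from left to right, each pair of successive entries $e_i, e_{i+1}$, neither of which belongs to a block already, with $e_{i+1} = e_i + 1$ forms one $b$-block. Step 3: each remaining entry forms a $c$-block by itself. Let $b(e)$ and $c(e)$ be the numbers of $b$-blocks and $c$-blocks, and let $\Sigma(e) = \sum_{i=1}^n e_i$. Let $P$ be a finite abelian $2$-group of type $e$, i.e. $P \cong \bigoplus_{i=1}^n \mathbb{Z}/2^{e_i}\mathbb{Z}$. Then $$\mathrm{Spec}_R(P) = \{2^i \mid i \in \mathbb{Z},\ b(e)+c(e)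 \leq i \leq \Sigma(e)\}.$$ -/

import Mathlib

namespace Reidemeister

/-- Twisted conjugacy for an endomorphism `φ` of a group `G` (written additively, not assumed
commutative): `x` and `y` are `φ`-conjugate if `x = z + y - φ z` for some `z`. -/
def twistedConj {G : Type*} [AddGroup G] (φ : G →+ G) : Setoid G where
  r x y := ∃ z : G, x = z + y - φ z
  iseqv :=
    { refl := fun x => ⟨0, by simp⟩
      symm := by
        rintro x y ⟨z, rfl⟩
        exact ⟨-z, by simp [sub_eq_add_neg, add_assoc]⟩
      trans := by
        rintro x y w ⟨z, rfl⟩ ⟨z', rfl⟩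
        exact ⟨z + z', by simp [sub_eq_add_neg, add_assoc]⟩ }

/-- The Reidemeister number `R(φ)`: the number (possibly `∞`) of `φ`-conjugacy classes. -/
noncomputable def reidemeisterNumber {G : Type*} [AddGroup G] (φ : G →+ G) : ℕ∞ :=
  ENat.card (Quotient (twistedConj φ))

/-- The Reidemeister spectrum of `G`: the Reidemeister numbers of all automorphisms of `G`. -/
def reidemeisterSpectrum (G : Type*) [AddGroup G] : Set ℕ∞ :=
  {r | ∃ ψ : G ≃+ G, reidemeisterNumber ψ.toAddMonoidHom = r}

/-- `e` belongs to `E(n)`: it is a non-decreasing tuple of positive integers. -/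
def MemE {n : ℕ} (e : Fin n → ℕ) : Prop :=
  (∀ i, 1 ≤ e i) ∧ Monotone e

/-- `P` is an abelian `p`-group of type `e`: it is isomorphic to `⨁ i, ℤ / p ^ (e i)`. -/
def HasType (p : ℕ) {n : ℕ} (e : Fin n → ℕ) (P : Type*) [AddCommGroup P] : Prop :=
  Nonempty (P ≃+ ((i : Fin n) → ZMod (p ^ e i)))

/-- The entry at position `i` lies in an `a`-block, i.e. in a constant subsequence of length at
least two (for a non-decreasing tuple equal entries are consecutive). -/
def InABlock {n : ℕ} (e : Fin n → ℕ) (i : Fin n) : Prop :=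
  ∃ j, j ≠ i ∧ e j = e i

instance {n : ℕ} (e : Fin n → ℕ) (i : Fin n) : Decidable (InABlock e i) :=
  inferInstanceAs (Decidable (∃ j, j ≠ i ∧ e j = e i))

/-- The (zero-based) positions `i` and `i + 1` exist, neither lies in an `a`-block, and the entry
at `i + 1` is one more than the entry at `i`. -/
def IsCandidatePair {n : ℕ} (e : Fin n → ℕ) (i : ℕ) : Prop :=
  ∃ h : i + 1 < n, ¬ InABlock e ⟨i, Nat.lt_of_succ_lt h⟩ ∧ ¬ InABlock e ⟨i + 1, h⟩ ∧
    e ⟨i + 1, h⟩ = e ⟨i, Nat.lt_of_succ_lt h⟩ + 1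

instance {n : ℕ} (e : Fin n → ℕ) (i : ℕ) : Decidable (IsCandidatePair e i) :=
  inferInstanceAs (Decidable (∃ h : i + 1 < n, ¬ InABlock e ⟨i, Nat.lt_of_succ_lt h⟩ ∧
    ¬ InABlock e ⟨i + 1, h⟩ ∧ e ⟨i + 1, h⟩ = e ⟨i, Nat.lt_of_succ_lt h⟩ + 1))

/-- Positions `i` and `i + 1` form a `b`-block. Candidate pairs are selected greedily from the
left: a candidate pair is taken unless its first entry is already the second entry of a
`b`-block. -/
def StartsBBlock {n : ℕ} (e : Fin n → ℕ) : ℕ → Prop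
  | 0 => IsCandidatePair e 0
  | i + 1 => IsCandidatePair e (i + 1) ∧ ¬ StartsBBlock e i

instance instDecidableStartsBBlock {n : ℕ} (e : Fin n → ℕ) :
    (i : ℕ) → Decidable (StartsBBlock e i)
  | 0 => inferInstanceAs (Decidable (IsCandidatePair e 0))
  | i + 1 =>
    haveI := instDecidableStartsBBlock e i
    inferInstanceAs (Decidable (IsCandidatePair e (i + 1) ∧ ¬ StartsBBlock e i))

/-- The entry at position `i` lies in a `b`-block, as its first or as its second entry. -/
def InBBlock {n : ℕ} (e : Fin n → ℕ) (i : Fin n) : Prop :=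
  StartsBBlock e i ∨ ∃ j : Fin n, (j : ℕ) + 1 = i ∧ StartsBBlock e j

instance {n : ℕ} (e : Fin n → ℕ) (i : Fin n) : Decidable (InBBlock e i) :=
  inferInstanceAs (Decidable (StartsBBlock e i ∨
    ∃ j : Fin n, (j : ℕ) + 1 = i ∧ StartsBBlock e j))

/-- `b(e)`: the number of `b`-blocks of `e`. -/
def bCount {n : ℕ} (e : Fin n → ℕ) : ℕ :=
  (Finset.univ.filter fun i : Fin n => StartsBBlock e i).card

/-- `c(e)`: the number of `c`-blocks of `e`; each entry that lies in no `a`-block and in no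
`b`-block forms one. -/
def cCount {n : ℕ} (e : Fin n → ℕ) : ℕ :=
  (Finset.univ.filter fun i : Fin n => ¬ InABlock e i ∧ ¬ InBBlock e i).card

/-- `Σ(e)`: the sum of the entries of `e`. -/
def total {n : ℕ} (e : Fin n → ℕ) : ℕ :=
  ∑ i, e i

end Reidemeister

namespace Reidemeister

/-! In a finite abelian group the twisted classes of ψ are the cosets of the image of 1 - ψ, so R(ψ)
is the order of its kernel, the group of fixed points. This order divides |P| = 2^Σ, which gives the
upper end.

Lower end (`two_pow_card_le_card_fixedPoints`): let S hold the first entries of b-blocks and the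
c-blocks. Its values occur once in e, and no two of them are consecutive integers
(`blockStarts_ne_add_one`). A subgroup D, cut out by divisibility conditions on coordinates, is
mapped by 1 - ψ into a subgroup of index 2^|S| in D, so the kernel has at least 2^|S| elements.

Realization (`attains_of_le`): an a-block attains every exponent from 0 to its sum, a b- or c-block
every exponent from 1 to its sum. Exponents add over products of automorphisms, so every value from
b(e) + c(e) to Σ(e) occurs. -/

/-- The subgroup of fixed points of an automorphism of an abelian group. -/
def fixedPoints {G : Type*} [AddCommGroup G] (ψ : G ≃+ G) : AddSubgroup G :=
  (AddMonoidHom.id G - ψ.toAddMonoidHom).ker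

theorem mem_fixedPoints {G : Type*} [AddCommGroup G] (ψ : G ≃+ G) (x : G) :
    x ∈ fixedPoints ψ ↔ ψ x = x := by
  rw [fixedPoints, AddMonoidHom.mem_ker, AddMonoidHom.sub_apply, sub_eq_zero, eq_comm]; rfl

theorem reidemeisterNumber_eq_card_fixedPoints {G : Type*} [AddCommGroup G] [Finite G]
    (ψ : G ≃+ G) :
    reidemeisterNumber ψ.toAddMonoidHom = (Nat.card (fixedPoints ψ) : ℕ∞) := by
  have h : twistedConj ψ.toAddMonoidHom =
      QuotientAddGroup.leftRel (AddMonoidHom.id G - ψ.toAddMonoidHom).range := by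
    ext x y
    rw [QuotientAddGroup.leftRel_apply, AddMonoidHom.mem_range]
    constructor
    · rintro ⟨z, rfl⟩
      refine ⟨-z, ?_⟩
      simp
      abel
    · rintro ⟨z, hz⟩
      refine ⟨-z, ?_⟩
      simp only [AddMonoidHom.sub_apply, AddMonoidHom.id_apply] at hz
      have h : x = y - (z - ψ.toAddMonoidHom z) := by rw [hz]; abel
      rw [map_neg]
      exact h.trans (by abel)
  unfold reidemeisterNumber
  rw [h]
  have h2 := AddSubgroup.index_range (f := AddMonoidHom.id G - ψ.toAddMonoidHom)
  rw [fixedPoints, ← h2, AddSubgroup.index]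
  exact ENat.card_eq_coe_natCard (G ⧸ (AddMonoidHom.id G - ψ.toAddMonoidHom).range)

theorem card_fixedPoints_congr {G H : Type*} [AddCommGroup G] [AddCommGroup H] (f : G ≃+ H)
    (ψ : G ≃+ G) :
    Nat.card (fixedPoints ((f.symm.trans ψ).trans f)) = Nat.card (fixedPoints ψ) := by
  refine Nat.card_congr (f.symm.toEquiv.subtypeEquiv fun x => ?_)
  rw [mem_fixedPoints, mem_fixedPoints]
  simp [← AddEquiv.eq_symm_apply]

/-! ### Fixed-point counts under isomorphisms and products. -/

/-- Some automorphism of `G` has exactly `2 ^ t` fixed points. -/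
def Attains (G : Type*) [AddCommGroup G] (t : ℕ) : Prop :=
  ∃ ψ : G ≃+ G, Nat.card (fixedPoints ψ) = 2 ^ t

theorem Attains.congr {G H : Type*} [AddCommGroup G] [AddCommGroup H] (f : G ≃+ H) {t : ℕ}
    (h : Attains G t) : Attains H t := by
  obtain ⟨ψ, hψ⟩ := h
  exact ⟨_, (card_fixedPoints_congr f ψ).trans hψ⟩

theorem Attains.pi {ι : Type*} [Fintype ι] {G : ι → Type*} [∀ i, AddCommGroup (G i)]
    {t : ι → ℕ} (h : ∀ i, Attains (G i) (t i)) : Attains (∀ i, G i) (∑ i, t i) := by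
  choose ψ hψ using h
  refine ⟨AddEquiv.piCongrRight ψ, ?_⟩
  rw [← Finset.prod_pow_eq_pow_sum, ← Finset.prod_congr rfl fun i _ => hψ i, ← Nat.card_pi]
  refine Nat.card_congr
    { toFun := fun x i => ⟨x.1 i, ?_⟩
      invFun := fun x => ⟨fun i => (x i).1, ?_⟩
      left_inv := fun _ => rfl
      right_inv := fun _ => rfl }
  · rw [mem_fixedPoints]
    exact congrFun ((mem_fixedPoints _ _).1 x.2) i
  · rw [mem_fixedPoints]
    exact funext fun i => (mem_fixedPoints _ _).1 (x i).2

theorem Attains.prod {G H : Type*} [AddCommGroup G] [AddCommGroup H] {s t : ℕ}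
    (hG : Attains G s) (hH : Attains H t) : Attains (G × H) (s + t) := by
  obtain ⟨φ, hφ⟩ := hG
  obtain ⟨ψ, hψ⟩ := hH
  refine ⟨AddEquiv.prodCongr φ ψ, ?_⟩
  rw [pow_add, ← hφ, ← hψ, ← Nat.card_prod]
  refine Nat.card_congr
    { toFun := fun x => (⟨x.1.1, ?_⟩, ⟨x.1.2, ?_⟩)
      invFun := fun x => ⟨(x.1.1, x.2.1), ?_⟩
      left_inv := fun _ => rfl
      right_inv := fun _ => rfl }
  · rw [mem_fixedPoints]
    exact congrArg Prod.fst ((mem_fixedPoints _ _).1 x.2)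
  · rw [mem_fixedPoints]
    exact congrArg Prod.snd ((mem_fixedPoints _ _).1 x.2)
  · rw [mem_fixedPoints]
    exact Prod.ext ((mem_fixedPoints _ _).1 x.1.2) ((mem_fixedPoints _ _).1 x.2.2)

theorem attains_of_injective {G : Type*} [AddCommGroup G] [Finite G] (φ : G →+ G) {t : ℕ}
    (hφ : ∀ x, φ x = 0 → x = 0) (ht : Nat.card {x // φ x = x} = 2 ^ t) : Attains G t := by
  have hinj : Function.Injective φ := (injective_iff_map_eq_zero φ).2 hφ
  refine ⟨AddEquiv.ofBijective φ ⟨hinj, Finite.injective_iff_surjective.1 hinj⟩, ?_⟩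
  rw [← ht]
  exact Nat.card_congr (Equiv.subtypeEquivRight fun x => mem_fixedPoints _ x)

/-! ### Automorphisms of cyclic groups and of products of two cyclic groups. -/

theorem card_pow_mul_eq_zero {e t : ℕ} (h : t ≤ e) :
    Nat.card {x : ZMod (2 ^ e) // (2 : ZMod (2 ^ e)) ^ t * x = 0} = 2 ^ t := by
  have := IsAddCyclic.card_nsmulAddMonoidHom_ker (ZMod (2 ^ e)) (2 ^ t)
  rw [Nat.card_zmod, Nat.gcd_eq_right (pow_dvd_pow 2 h)] at this
  rw [← this]
  refine Nat.card_congr (Equiv.subtypeEquivRight fun x => ?_)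
  rw [AddMonoidHom.mem_ker]
  simp [nsmul_eq_mul]

theorem isUnit_one_add_two_pow {e t : ℕ} (ht : 1 ≤ t) :
    IsUnit (1 + (2 : ZMod (2 ^ e)) ^ t) := by
  have h : (1 + (2 : ZMod (2 ^ e)) ^ t) = ((1 + 2 ^ t : ℕ) : ZMod (2 ^ e)) := by push_cast; rfl
  rw [h, ZMod.isUnit_iff_coprime]
  refine Nat.Coprime.pow_right e ?_
  obtain ⟨s, rfl⟩ := Nat.exists_eq_add_of_le' ht
  rw [pow_succ]
  simp

/-- Multiplication by 1 + 2^t fixes exactly the 2^t-torsion; it is invertible because t ≥ 1. -/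
theorem attains_zmod {e t : ℕ} (h1 : 1 ≤ t) (h2 : t ≤ e) : Attains (ZMod (2 ^ e)) t := by
  refine attains_of_injective (AddMonoidHom.mulLeft (1 + (2 : ZMod (2 ^ e)) ^ t)) ?_ ?_
  · intro x hx
    exact (isUnit_one_add_two_pow h1).mul_right_eq_zero.1 hx
  · rw [← card_pow_mul_eq_zero h2]
    refine Nat.card_congr (Equiv.subtypeEquivRight fun x => ?_)
    simp [add_mul]

theorem attains_prod_of_two_le {d e t : ℕ} (hd : 1 ≤ d) (he : 1 ≤ e) (h1 : 2 ≤ t)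
    (h2 : t ≤ d + e) : Attains (ZMod (2 ^ d) × ZMod (2 ^ e)) t := by
  by_cases h : t ≤ d + 1
  · have := (attains_zmod (e := d) (t := t - 1) (by omega) (by omega)).prod
      (attains_zmod (e := e) (t := 1) le_rfl he)
    rwa [Nat.sub_add_cancel (by omega)] at this
  · have := (attains_zmod (e := d) (t := d) hd le_rfl).prod
      (attains_zmod (e := e) (t := t - d) (by omega) (by omega))
    rwa [Nat.add_sub_cancel' (by omega)] at this

/-- The map (x, y) ↦ (x - 2y, y - x) has determinant -1, and its fixed points are given by x = 0, 2y
= 0. -/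
theorem attains_one_of_eq {e : ℕ} (he : 1 ≤ e) :
    Attains (ZMod (2 ^ e) × ZMod (2 ^ e)) 1 := by
  let R := ZMod (2 ^ e)
  let p : R × R →+ R := AddMonoidHom.fst R R
  let q : R × R →+ R := AddMonoidHom.snd R R
  refine attains_of_injective (AddMonoidHom.prod (p - (2 : ℕ) • q) (q - p)) ?_ ?_
  · rintro ⟨x, y⟩ h
    obtain ⟨h1, h2⟩ := Prod.ext_iff.1 h
    simp [p, q] at h1 h2
    have hy : y = 0 := by linear_combination -h1 - h2
    have hx : x = 0 := by linear_combination -h1 - 2 * h2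
    rw [hx, hy]; rfl
  · rw [← card_pow_mul_eq_zero he]
    refine Nat.card_congr
      { toFun := fun x => ⟨x.1.2, ?_⟩
        invFun := fun y => ⟨(0, y.1), ?_⟩
        left_inv := fun x => ?_
        right_inv := fun _ => rfl }
    · have := congrArg Prod.fst x.2
      simpa [p, q] using this
    · have := y.2
      refine Prod.ext ?_ ?_
      · simpa [p, q] using y.2
      · simp [p, q]
    · have := congrArg Prod.snd x.2
      simp [p, q] at this
      exact Subtype.ext (Prod.ext this.symm rfl)

/-- With r the reduction and u the injection induced by doubling, ur and ru are both multiplication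
by 2. Hence (x, y) ↦ (x - r y, y - u x) behaves like a matrix of determinant 1 - 2 = -1, and it
fixes only the pairs with x = 0 and y in the kernel of r, which has order 2. -/
theorem attains_one_of_succ (e : ℕ) :
    Attains (ZMod (2 ^ e) × ZMod (2 ^ (e + 1))) 1 := by
  let R := ZMod (2 ^ e)
  let S := ZMod (2 ^ (e + 1))
  let r : S →+ R := (ZMod.castHom (pow_dvd_pow 2 (Nat.le_succ e)) R).toAddMonoidHom
  have h0 : (2 : S) * ((2 ^ e : ℕ) : S) = 0 := by
    have h : ((2 ^ (e + 1) : ℕ) : S) = 0 := ZMod.natCast_self _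
    rw [← h]
    push_cast
    ring
  let u : R →+ S := ZMod.lift (2 ^ e) ⟨(AddMonoidHom.mulLeft (2 : S)).comp
    (Int.castAddHom S), by simpa using h0⟩
  have huk : ∀ k : ℤ, u k = 2 * k := fun k => ZMod.lift_coe _ _ k
  have hrk : ∀ k : ℤ, r k = k := fun k => map_intCast (ZMod.castHom (pow_dvd_pow 2 (Nat.le_succ e)) R) k
  have hu : ∀ y, u (r y) = 2 * y := by
    intro y
    obtain ⟨k, rfl⟩ := ZMod.intCast_surjective y
    rw [hrk, huk]
  have hr : ∀ x, r (u x) = 2 * x := by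
    intro x
    obtain ⟨k, rfl⟩ := ZMod.intCast_surjective x
    have h : (2 : S) * (k : S) = ((2 * k : ℤ) : S) := by rw [Int.cast_mul, Int.cast_ofNat]
    rw [huk, h, hrk, Int.cast_mul, Int.cast_ofNat]
  have hu0 : ∀ x, u x = 0 → x = 0 := by
    intro x hx
    obtain ⟨k, rfl⟩ := ZMod.intCast_surjective x
    have h3 : ((2 * k : ℤ) : S) = 0 := by
      rw [← hx, huk, Int.cast_mul, Int.cast_ofNat]
    rw [ZMod.intCast_zmod_eq_zero_iff_dvd] at h3 ⊢
    push_cast [pow_succ'] at h3 ⊢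
    exact (mul_dvd_mul_iff_left two_ne_zero).1 h3
  have hrs : Function.Surjective r :=
    ZMod.castHom_surjective (pow_dvd_pow 2 (Nat.le_succ e))
  let p : R × S →+ R := AddMonoidHom.fst R S
  let q : R × S →+ S := AddMonoidHom.snd R S
  refine attains_of_injective (AddMonoidHom.prod (p - r.comp q) (q - u.comp p)) ?_ ?_
  · rintro ⟨x, y⟩ h
    obtain ⟨h1, h2⟩ := Prod.ext_iff.1 h
    simp [p, q] at h1 h2
    have h3 := congrArg r h2
    rw [map_sub, hr, map_zero] at h3
    have hx : x = 0 := by linear_combination -h1 - h3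
    rw [hx, map_zero, sub_zero] at h2
    rw [hx, h2]; rfl
  · have hc : Nat.card r.ker = 2 ^ 1 := by
      have h := r.ker.index_mul_card
      rw [AddSubgroup.index_ker, AddMonoidHom.range_eq_top.2 hrs, AddSubgroup.card_top,
        Nat.card_zmod, Nat.card_zmod] at h
      rw [pow_one]
      exact Nat.eq_of_mul_eq_mul_left (by positivity) (h.trans (pow_succ 2 e))
    rw [← hc]
    refine Nat.card_congr
      { toFun := fun x => ⟨x.1.2, ?_⟩
        invFun := fun y => ⟨(0, y.1), ?_⟩
        left_inv := fun x => ?_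
        right_inv := fun _ => rfl }
    · have := congrArg Prod.fst x.2
      simpa [p, q, AddMonoidHom.mem_ker] using this
    · have := y.2
      rw [AddMonoidHom.mem_ker] at this
      refine Prod.ext ?_ ?_
      · simpa [p, q] using this
      · simp [p, q]
    · have := congrArg Prod.snd x.2
      simp [p, q] at this
      exact Subtype.ext (Prod.ext (hu0 _ this).symm rfl)

/-! ### Homocyclic groups: the a-blocks. -/

/-- A cyclic shift with x 0 added in coordinate 0. For a fixed point, coordinate 0 forces x 1 = 0,
the shift carries this zero to all later coordinates, and the last coordinate brings it back to x 0.
-/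
theorem attains_zero_fin {A : Type*} [AddCommGroup A] [Finite A] (m : ℕ) :
    Attains (Fin (m + 2) → A) 0 := by
  let φ : (Fin (m + 2) → A) →+ (Fin (m + 2) → A) :=
    { toFun := fun x i => x (i + 1) + if i = 0 then x 0 else 0
      map_zero' := by ext; simp
      map_add' := by
        intro x y
        ext i
        by_cases h : i = 0
        · simp [h]; abel
        · simp [h] }
  have hφ : ∀ x i, φ x i = x (i + 1) + if i = 0 then x 0 else 0 := fun _ _ => rfl
  have hlast : Fin.last (m + 1) ≠ 0 := (Fin.last_pos).ne'
  refine attains_of_injective φ ?_ ?_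
  · intro x h
    have h1 : ∀ i, x (i + 1) + (if i = 0 then x 0 else 0) = 0 := fun i => congrFun h i
    have h0 : x 0 = 0 := by simpa [hlast] using h1 (Fin.last (m + 1))
    funext i
    have := h1 (i - 1)
    simpa [h0] using this
  · rw [pow_zero, Nat.card_eq_one_iff_unique]
    refine ⟨⟨fun x y => ?_⟩, ⟨⟨0, map_zero φ⟩⟩⟩
    suffices H : ∀ x : {x // φ x = x}, x.1 = 0 from Subtype.ext ((H x).trans (H y).symm)
    rintro ⟨x, hx⟩
    have h1 : ∀ i, x (i + 1) + (if i = 0 then x 0 else 0) = x i := fun i => congrFun hx i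
    have h2 : x 1 = 0 := by simpa using h1 0
    have h3 : ∀ j : Fin (m + 1), x j.succ = 0 := by
      intro j
      induction j using Fin.induction with
      | zero => exact h2
      | succ j ih =>
        have := h1 j.succ.castSucc
        rw [Fin.coeSucc_eq_succ, if_neg (by simp [Fin.ext_iff]), add_zero] at this
        rw [this]
        exact ih
    have h4 : x 0 = 0 := by
      have := h1 (Fin.last (m + 1))
      rw [Fin.last_add_one, if_neg hlast, add_zero] at this
      exact this.trans (h3 (Fin.last m))
    exact funext fun i => Fin.cases h4 h3 i

/-- `Fin.consEquiv` for constant families, as an additive isomorphism. -/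
def finConsAddEquiv (A : Type*) [AddCommGroup A] (n : ℕ) : A × (Fin n → A) ≃+ (Fin (n + 1) → A) :=
  { Fin.consEquiv (fun _ => A) with
    map_add' := fun x y => by
      ext i
      refine Fin.cases ?_ (fun j => ?_) i <;> simp [Fin.consEquiv] }

/-- `finTwoArrowEquiv`, inverted, as an additive isomorphism. -/
def finTwoAddEquiv (A : Type*) [AddCommGroup A] : A × A ≃+ (Fin 2 → A) :=
  { (finTwoArrowEquiv A).symm with
    map_add' := fun x y => by
      ext i
      fin_cases i <;> simp [finTwoArrowEquiv] }

theorem attains_fin_two_add {e : ℕ} (he : 1 ≤ e) (m t : ℕ) (ht : t ≤ (m + 2) * e) :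
    Attains (Fin (m + 2) → ZMod (2 ^ e)) t := by
  induction m generalizing t with
  | zero =>
    rcases t with _ | _ | t
    · exact attains_zero_fin 0
    · exact (attains_one_of_eq he).congr (finTwoAddEquiv _)
    · exact (attains_prod_of_two_le he he (by omega) (by omega)).congr (finTwoAddEquiv _)
  | succ m ih =>
    rcases Nat.eq_zero_or_pos t with rfl | ht0
    · exact attains_zero_fin (m + 1)
    · have h : (m + 1 + 2) * e = (m + 2) * e + e := by ring
      by_cases hte : t ≤ e
      · have := (attains_zmod ht0 hte).prod (ih 0 (Nat.zero_le _))
        exact this.congr (finConsAddEquiv _ _)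
      · have := (attains_zmod he le_rfl).prod (ih (t - e) (by omega))
        rw [Nat.add_sub_cancel' (by omega)] at this
        exact this.congr (finConsAddEquiv _ _)

theorem attains_pi_const {ι : Type*} [Fintype ι] (f : ι → ℕ) {e : ℕ} (he : 1 ≤ e)
    (hf : ∀ i, f i = e) (hι : 2 ≤ Fintype.card ι) {t : ℕ} (ht : t ≤ Fintype.card ι * e) :
    Attains (∀ i, ZMod (2 ^ f i)) t := by
  obtain ⟨m, hm⟩ := Nat.exists_eq_add_of_le' hι
  rw [hm] at ht
  have h := attains_fin_two_add he m t ht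
  have h2 := h.congr (AddEquiv.arrowCongr (Fintype.equivFinOfCardEq hm).symm (AddEquiv.refl _))
  exact h2.congr (AddEquiv.piCongrRight fun i =>
    (ZMod.ringEquivCongr (by rw [hf i])).toAddEquiv)

/-! ### Assembling blocks. -/

theorem attains_pi_unique {ι : Type*} [Fintype ι] (f : ι → ℕ) (i : ι) (hi : ∀ j, j = i)
    {t : ℕ} (h : Attains (ZMod (2 ^ f i)) t) : Attains (∀ i, ZMod (2 ^ f i)) t := by
  refine h.congr (AddEquiv.ofBijective (Pi.evalAddMonoidHom (fun i => ZMod (2 ^ f i)) i)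
    ⟨fun x y hxy => ?_, Function.surjective_eval i⟩).symm
  funext j
  obtain rfl := hi j
  exact hxy

theorem attains_pi_pair {ι : Type*} [Fintype ι] (f : ι → ℕ) (i j : ι) (hij : i ≠ j)
    (hi : ∀ k, k = i ∨ k = j) {t : ℕ} (h : Attains (ZMod (2 ^ f i) × ZMod (2 ^ f j)) t) :
    Attains (∀ i, ZMod (2 ^ f i)) t := by
  classical
  refine h.congr (AddEquiv.ofBijective (AddMonoidHom.prod
    (Pi.evalAddMonoidHom (fun i => ZMod (2 ^ f i)) i)
    (Pi.evalAddMonoidHom (fun i => ZMod (2 ^ f i)) j)) ⟨fun x y hxy => ?_, fun x => ?_⟩).symm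
  · funext k
    rcases hi k with rfl | rfl
    · exact congrArg Prod.fst hxy
    · exact congrArg Prod.snd hxy
  · refine ⟨Function.update (Function.update 0 i x.1) j x.2, Prod.ext ?_ ?_⟩
    · simp [hij]
    · simp

theorem attains_pi_empty {ι : Type*} [IsEmpty ι] (f : ι → ℕ) :
    Attains (∀ i, ZMod (2 ^ f i)) 0 := by
  refine ⟨AddEquiv.refl _, ?_⟩
  rw [pow_zero, Nat.card_eq_one_iff_unique]
  exact ⟨inferInstance, inferInstance⟩

/-- A number between two sums is a sum of numbers between the summands. -/
theorem exists_sum_eq_of_le {ι : Type*} (s : Finset ι) (l u : ι → ℕ) (h : ∀ i ∈ s, l i ≤ u i)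
    {t : ℕ} (h1 : ∑ i ∈ s, l i ≤ t) (h2 : t ≤ ∑ i ∈ s, u i) :
    ∃ f : ι → ℕ, (∀ i ∈ s, l i ≤ f i ∧ f i ≤ u i) ∧ ∑ i ∈ s, f i = t := by
  classical
  induction s using Finset.induction_on generalizing t with
  | empty => exact ⟨l, by simp, by simpa [eq_comm] using h2⟩
  | insert a s ha ih =>
    rw [Finset.sum_insert ha] at h1 h2
    have hs : ∑ i ∈ s, l i ≤ ∑ i ∈ s, u i :=
      Finset.sum_le_sum fun i hi => h i (Finset.mem_insert_of_mem hi)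
    have hla := h a (Finset.mem_insert_self a s)
    obtain ⟨c, hc1, hc2, hc3, hc4, hc5⟩ : ∃ c, l a ≤ c ∧ c ≤ u a ∧ c ≤ t ∧
        ∑ i ∈ s, l i ≤ t - c ∧ t - c ≤ ∑ i ∈ s, u i :=
      -- The smallest admissible c that leaves a remainder within the upper bounds of `s`.
      ⟨max (l a) (t - ∑ i ∈ s, u i), by omega, by omega, by omega, by omega, by omega⟩
    obtain ⟨f, hf, hft⟩ := ih (fun i hi => h i (Finset.mem_insert_of_mem hi)) hc4 hc5
    refine ⟨Function.update f a c, fun i hi => ?_, ?_⟩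
    · rcases Finset.mem_insert.1 hi with rfl | hi
      · simp [hc1, hc2]
      · rw [Function.update_of_ne (ne_of_mem_of_not_mem hi ha)]
        exact hf i hi
    · rw [Finset.sum_insert ha, Function.update_self, Finset.sum_update_of_notMem ha, hft]
      omega

theorem attains_pi_of_fibers {ι κ : Type*} [Fintype ι] [Fintype κ] [DecidableEq κ] (f : ι → ℕ)
    (β : ι → κ) (l : κ → ℕ)
    (h : ∀ k, l k ≤ ∑ i : {i // β i = k}, f i ∧ ∀ t, l k ≤ t → t ≤ ∑ i : {i // β i = k}, f i →
      Attains (∀ i : {i // β i = k}, ZMod (2 ^ f i)) t)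
    {t : ℕ} (h1 : ∑ k, l k ≤ t) (h2 : t ≤ ∑ i, f i) : Attains (∀ i, ZMod (2 ^ f i)) t := by
  rw [← Fintype.sum_fiberwise β f] at h2
  obtain ⟨g, hg, rfl⟩ := exists_sum_eq_of_le Finset.univ l _ (fun k _ => (h k).1) h1 h2
  refine (Attains.pi fun k => (h k).2 (g k) (hg k (Finset.mem_univ k)).1
    (hg k (Finset.mem_univ k)).2).congr
    { toFun := fun (x : ∀ k, ∀ i : {i // β i = k}, ZMod (2 ^ f i)) (i : ι) => x (β i) ⟨i, rfl⟩
      invFun := fun (x : ∀ i, ZMod (2 ^ f i)) k (i : {i // β i = k}) => x i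
      left_inv := fun x => by
        funext k i
        obtain ⟨i, rfl⟩ := i
        rfl
      right_inv := fun _ => rfl
      map_add' := fun _ _ => rfl }

/-! ### The lower bound for fixed points. -/

/-- The tuples whose entry at each position `i` is divisible by `2 ^ m i`. -/
def divSubgroup {ι : Type*} (e m : ι → ℕ) : AddSubgroup (∀ i, ZMod (2 ^ e i)) :=
  AddSubgroup.pi Set.univ fun i => (nsmulAddMonoidHom (α := ZMod (2 ^ e i)) (2 ^ m i)).range

theorem mem_divSubgroup {ι : Type*} (e m : ι → ℕ) (x : ∀ i, ZMod (2 ^ e i)) :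
    x ∈ divSubgroup e m ↔ ∀ i, (2 : ZMod (2 ^ e i)) ^ m i ∣ x i := by
  simp only [divSubgroup, AddSubgroup.mem_pi, Set.mem_univ, true_imp_iff, AddMonoidHom.mem_range]
  refine forall_congr' fun i => exists_congr fun y => ?_
  simp [nsmul_eq_mul, eq_comm]

theorem card_divSubgroup {ι : Type*} [Fintype ι] (e m : ι → ℕ) (hm : ∀ i, m i ≤ e i) :
    Nat.card (divSubgroup e m) = ∏ i, 2 ^ (e i - m i) := by
  have h : Nat.card (divSubgroup e m) =
      ∏ i, Nat.card (nsmulAddMonoidHom (α := ZMod (2 ^ e i)) (2 ^ m i)).range := by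
    rw [← Nat.card_pi]
    exact Nat.card_congr
      { toFun := fun x i => ⟨x.1 i, x.2 i (Set.mem_univ i)⟩
        invFun := fun x => ⟨fun i => (x i).1, fun i _ => (x i).2⟩
        left_inv := fun _ => rfl
        right_inv := fun _ => rfl }
  rw [h]
  refine Finset.prod_congr rfl fun i _ => ?_
  rw [IsAddCyclic.card_nsmulAddMonoidHom_range, Nat.card_zmod,
    Nat.gcd_eq_right (pow_dvd_pow 2 (hm i)), Nat.pow_div (hm i) two_pos]

/-- The j-th generator is killed by 2^(e j), hence so is its image; in `ZMod (2 ^ e i)` this forces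
divisibility by 2^(e i - e j), with truncated subtraction. -/
theorem two_pow_dvd_map_single {ι : Type*} [DecidableEq ι] (e : ι → ℕ)
    (f : (∀ i, ZMod (2 ^ e i)) →+ (∀ i, ZMod (2 ^ e i))) (i j : ι)
    {k : ℕ} {y : ZMod (2 ^ e j)} (hy : 2 ^ k ∣ y) :
    2 ^ (k + (e i - e j)) ∣ f (Pi.single j y) i := by
  obtain ⟨y, rfl⟩ := hy
  obtain ⟨n, rfl⟩ := ZMod.natCast_zmod_surjective y
  obtain ⟨w, hw⟩ := ZMod.natCast_zmod_surjective (f (Pi.single j 1) i)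
  have h1 : Pi.single (M := fun i => ZMod (2 ^ e i)) j (2 ^ k * (n : ZMod (2 ^ e j))) =
      (2 ^ k * n) • Pi.single j 1 := by
    rw [← Pi.single_smul]
    simp [nsmul_eq_mul]
  have h2 : 2 ^ (e i - e j) ∣ w := by
    have h : (2 ^ e j) • Pi.single (M := fun i => ZMod (2 ^ e i)) j 1 = 0 := by
      rw [← Pi.single_smul, nsmul_eq_mul, ZMod.natCast_self, zero_mul, Pi.single_zero]
    have h3 : ((2 ^ e j * w : ℕ) : ZMod (2 ^ e i)) = 0 := by
      have := congrFun (congrArg f h) i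
      rw [map_nsmul, map_zero, Pi.smul_apply, ← hw, nsmul_eq_mul] at this
      rw [Nat.cast_mul]
      exact this
    rw [ZMod.natCast_eq_zero_iff] at h3
    rcases le_total (e i) (e j) with hle | hle
    · rw [Nat.sub_eq_zero_of_le hle]; simp
    · refine Nat.dvd_of_mul_dvd_mul_left (pow_pos two_pos (e j)) ?_
      rwa [← pow_add, Nat.add_sub_cancel' hle]
  obtain ⟨v, rfl⟩ := h2
  rw [h1, map_nsmul, Pi.smul_apply, ← hw, nsmul_eq_mul, pow_add]
  push_cast
  exact ⟨n * v, by ring⟩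

/-- Where `e` takes a value only once, the diagonal coefficient of an automorphism is odd. -/
theorem two_dvd_one_sub_diagonal {ι : Type*} [DecidableEq ι] (e : ι → ℕ)
    (ψ : (∀ i, ZMod (2 ^ e i)) ≃+ (∀ i, ZMod (2 ^ e i))) (i : ι)
    (hi : 1 ≤ e i) (h1 : ∀ j, e j = e i → j = i) : 2 ∣ 1 - ψ (Pi.single i 1) i := by
  obtain ⟨w, hw⟩ := ZMod.natCast_zmod_surjective (ψ (Pi.single i 1) i)
  rcases Nat.even_or_odd w with hev | ⟨v, rfl⟩
  · exfalso
    have hz : ∀ k : ℕ, (2 : ZMod (2 ^ k)) ^ k = 0 := fun k => by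
      exact_mod_cast ZMod.natCast_self (2 ^ k)
    -- If the diagonal coefficient were even, ψ would send this nonzero element into the multiples
    -- of 2^(e i). Then u itself would be such a multiple, yet the i-th coordinate of any such
    -- multiple vanishes.
    let u : ∀ i, ZMod (2 ^ e i) := Pi.single i (2 ^ (e i - 1))
    have hu : ∀ j, 2 ^ e i ∣ ψ u j := by
      intro j
      have h2 := two_pow_dvd_map_single e ψ.toAddMonoidHom j i
        (dvd_refl ((2 : ZMod (2 ^ e i)) ^ (e i - 1)))
      rcases lt_trichotomy (e j) (e i) with h | h | h
      · have h3 := (pow_dvd_pow (2 : ZMod (2 ^ e j))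
          (by omega : e j ≤ e i - 1 + (e j - e i))).trans h2
        rw [hz, zero_dvd_iff] at h3
        exact (dvd_zero _).trans (dvd_of_eq h3.symm)
      · obtain rfl := h1 j h
        obtain ⟨v, rfl⟩ := hev
        have h4 : Pi.single (M := fun i => ZMod (2 ^ e i)) j (2 ^ (e j - 1)) =
            (2 ^ (e j - 1)) • Pi.single j 1 := by
          rw [← Pi.single_smul]
          simp [nsmul_eq_mul]
        simp only [u]
        rw [h4, map_nsmul, Pi.smul_apply, nsmul_eq_mul, ← hw]
        refine ⟨v, ?_⟩
        have h5 : (2 : ZMod (2 ^ e j)) ^ e j = 2 ^ (e j - 1) * 2 := by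
          rw [← pow_succ, Nat.sub_add_cancel hi]
        rw [h5]
        push_cast
        ring
      · exact (pow_dvd_pow 2 (by omega)).trans h2
    choose y hy using hu
    have h5 : u = (2 ^ e i) • ψ.symm y := by
      rw [← map_nsmul, AddEquiv.eq_symm_apply]
      funext j
      rw [hy j, Pi.smul_apply, nsmul_eq_mul]
      push_cast
      rfl
    have h6 := congrFun h5 i
    simp only [u] at h6
    rw [Pi.single_eq_same, Pi.smul_apply, nsmul_eq_mul, ZMod.natCast_self, zero_mul] at h6
    have h7 : ((2 ^ (e i - 1) : ℕ) : ZMod (2 ^ e i)) = 0 := by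
      rw [← h6]
      push_cast
      rfl
    rw [ZMod.natCast_eq_zero_iff, Nat.pow_dvd_pow_iff_le_right (by norm_num)] at h7
    omega
  · rw [← hw]
    exact ⟨-v, by push_cast; ring⟩

/-- The weights m are chosen so that 1 - ψ gains one factor of 2 in each coordinate of S: on the
diagonal by oddness of the coefficient of ψ, off the diagonal by the inequality `hmm`. Comparing
orders of the two subgroups bounds the kernel. -/
theorem two_pow_card_le_card_fixedPoints {ι : Type*} [Fintype ι] [DecidableEq ι] (e : ι → ℕ)
    (he : ∀ i, 1 ≤ e i) (S : Finset ι)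
    (h1 : ∀ s ∈ S, ∀ j, e j = e s → j = s) (h2 : ∀ s ∈ S, ∀ s' ∈ S, e s' ≠ e s + 1)
    (ψ : (∀ i, ZMod (2 ^ e i)) ≃+ (∀ i, ZMod (2 ^ e i))) :
    2 ^ S.card ≤ Nat.card (fixedPoints ψ) := by
  let c : ι → ℕ := fun i => if i ∈ S then 1 else 0
  let m : ι → ℕ := fun i => (S.filter fun s => e s < e i).card
  have hinj : ∀ T ⊆ S, Set.InjOn e T := fun T hT s _ t ht hst => h1 t (hT ht) s hst
  have hme : ∀ i, m i + c i ≤ e i := by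
    intro i
    have h : m i ≤ e i - 1 := by
      rw [← Nat.card_Ico 1 (e i)]
      refine Finset.card_le_card_of_injOn e (fun s hs => ?_) (hinj _ (Finset.filter_subset _ _))
      simp at hs
      simp [hs.2, he s]
    have := he i
    have : c i ≤ 1 := by dsimp [c]; split_ifs <;> simp
    omega
  have hmm : ∀ i j, j ≠ i → m i + c i ≤ m j + (e i - e j) := by
    intro i j hji
    rcases le_or_gt (e j) (e i) with h | h
    · have hle : m i ≤ m j + (e i - c i - e j) := by
        rw [← Nat.card_Ico]
        have hsub : (S.filter fun s => e s < e i) ⊆ (S.filter fun s => e s < e j) ∪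
            (S.filter fun s => e j ≤ e s ∧ e s < e i) := by
          intro s hs
          simp only [Finset.mem_filter, Finset.mem_union] at hs ⊢
          have := hs.1
          have := hs.2
          simp only [this, hs.1, true_and, and_true]
          omega
        refine (Finset.card_le_card hsub).trans ((Finset.card_union_le _ _).trans ?_)
        refine Nat.add_le_add_left ?_ _
        refine Finset.card_le_card_of_injOn e (fun s hs => ?_) (hinj _ (Finset.filter_subset _ _))
        simp at hs
        simp only [Finset.coe_Ico, Set.mem_Ico]
        refine ⟨hs.2.1, ?_⟩
        -- For i in S, no element of S has value e i - 1, which saves one in the count of values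
        -- from e j up to e i.
        by_cases hi : i ∈ S
        · have := h2 s hs.1 i hi
          simp only [c, hi, if_true]
          omega
        · simp only [c, hi, if_false]
          omega
      by_cases hi : i ∈ S
      · have hne : e j ≠ e i := fun hh => hji (h1 i hi j hh)
        simp only [c, hi, if_true] at hle ⊢
        omega
      · simp only [c, hi, if_false] at hle ⊢
        omega
    · have hsub : (S.filter fun s => e s < e i) ⊆ (S.filter fun s => e s < e j) := by
        intro s hs
        simp only [Finset.mem_filter] at hs ⊢
        exact ⟨hs.1, by omega⟩
      -- Here e i < e j, so an i in S is itself counted in `m j` but not in `m i`.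
      by_cases hi : i ∈ S
      · simp only [c, hi, if_true]
        have : m i < m j := Finset.card_lt_card (Finset.ssubset_iff_of_subset hsub |>.2
          ⟨i, by simp [hi, h], by simp⟩)
        omega
      · simp only [c, hi, if_false]
        have : m i ≤ m j := Finset.card_le_card hsub
        omega
  let N := AddMonoidHom.id _ - ψ.toAddMonoidHom
  have hN : ∀ x ∈ divSubgroup e m, N x ∈ divSubgroup e (fun i => m i + c i) := by
    intro x hx
    rw [mem_divSubgroup] at hx ⊢
    intro i
    have hx2 : N x i = ∑ j, N (Pi.single j (x j)) i := by
      conv_lhs => rw [← Finset.univ_sum_single x]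
      rw [map_sum, Finset.sum_apply]
    rw [hx2]
    refine Finset.dvd_sum fun j _ => ?_
    by_cases hji : j = i
    · subst hji
      by_cases hj : j ∈ S
      · have hd := two_dvd_one_sub_diagonal e ψ j (he j) (h1 j hj)
        have h3 : N (Pi.single j (x j)) j = x j * (1 - ψ (Pi.single j 1) j) := by
          obtain ⟨n, hn⟩ := ZMod.natCast_zmod_surjective (x j)
          have : Pi.single (M := fun i => ZMod (2 ^ e i)) j (x j) = n • Pi.single j 1 := by
            rw [← Pi.single_smul, ← hn]
            simp [nsmul_eq_mul]
          rw [this, map_nsmul, Pi.smul_apply, nsmul_eq_mul, hn]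
          simp [N]
        simp only [c, hj, if_true]
        rw [h3, pow_succ]
        exact mul_dvd_mul (hx j) hd
      · have := two_pow_dvd_map_single e N j j (hx j)
        simpa [c, hj] using this
    · exact (pow_dvd_pow 2 (hmm i j hji)).trans (two_pow_dvd_map_single e N i j (hx j))
  let g := N.comp (divSubgroup e m).subtype
  have hcard : Nat.card (divSubgroup e m) ≤
      Nat.card (divSubgroup e fun i => m i + c i) * Nat.card (fixedPoints ψ) := by
    rw [← g.ker.index_mul_card, AddSubgroup.index_ker]
    refine Nat.mul_le_mul ?_ ?_
    · refine AddSubgroup.card_le_of_le ?_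
      rintro _ ⟨x, rfl⟩
      exact hN x x.2
    · refine Nat.card_le_card_of_injective (fun x : g.ker => (⟨x.1.1, x.2⟩ : fixedPoints ψ)) ?_
      intro x y hxy
      exact Subtype.ext (Subtype.ext (congrArg (fun z : fixedPoints ψ => z.1) hxy))
  have hS : 2 ^ S.card = ∏ i, 2 ^ c i := by
    rw [Finset.prod_pow_eq_pow_sum]
    simp [c]
  have hAB : Nat.card (divSubgroup e m) =
      Nat.card (divSubgroup e fun i => m i + c i) * 2 ^ S.card := by
    rw [card_divSubgroup e _ hme, card_divSubgroup e m fun i => (Nat.le_add_right _ _).trans (hme i), hS,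
      ← Finset.prod_mul_distrib]
    refine Finset.prod_congr rfl fun i _ => ?_
    have := hme i
    rw [← pow_add]
    congr 1
    omega
  rw [hAB] at hcard
  exact Nat.le_of_mul_le_mul_left hcard Nat.card_pos

/-! ### Combinatorics of the block decomposition. -/

theorem StartsBBlock.isCandidatePair {n : ℕ} {e : Fin n → ℕ} {i : ℕ} (h : StartsBBlock e i) :
    IsCandidatePair e i := by
  cases i with
  | zero => exact h
  | succ i => exact h.1

theorem StartsBBlock.not_inABlock {n : ℕ} {e : Fin n → ℕ} {i : Fin n} (h : StartsBBlock e i) :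
    ¬ InABlock e i :=
  h.isCandidatePair.2.1

theorem StartsBBlock.not_inABlock_succ {n : ℕ} {e : Fin n → ℕ} {i j : Fin n}
    (h : StartsBBlock e j) (hij : (j : ℕ) + 1 = i) : ¬ InABlock e i := by
  have hi : i = ⟨j + 1, by omega⟩ := Fin.ext hij.symm
  rw [hi]
  exact h.isCandidatePair.2.2.1

theorem StartsBBlock.apply_succ {n : ℕ} {e : Fin n → ℕ} {i j : Fin n}
    (h : StartsBBlock e j) (hij : (j : ℕ) + 1 = i) : e i = e j + 1 := by
  have hi : i = ⟨j + 1, by omega⟩ := Fin.ext hij.symm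
  rw [hi]
  exact h.isCandidatePair.2.2.2

theorem StartsBBlock.not_succ {n : ℕ} {e : Fin n → ℕ} {i : ℕ} (h : StartsBBlock e i) :
    ¬ StartsBBlock e (i + 1) :=
  fun h' => h'.2 h

/-- The positions that start a `b`-block or form a `c`-block. -/
def blockStarts {n : ℕ} (e : Fin n → ℕ) : Finset (Fin n) :=
  (Finset.univ.filter fun i : Fin n => StartsBBlock e i) ∪
    Finset.univ.filter fun i : Fin n => ¬ InABlock e i ∧ ¬ InBBlock e i

theorem mem_blockStarts {n : ℕ} {e : Fin n → ℕ} {i : Fin n} :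
    i ∈ blockStarts e ↔ StartsBBlock e i ∨ ¬ InABlock e i ∧ ¬ InBBlock e i := by
  simp [blockStarts]

theorem card_blockStarts {n : ℕ} (e : Fin n → ℕ) :
    (blockStarts e).card = bCount e + cCount e := by
  refine Finset.card_union_of_disjoint (Finset.disjoint_left.2 fun i hi hi' => ?_)
  simp only [Finset.mem_filter] at hi hi'
  exact hi'.2.2 (Or.inl hi.2)

theorem not_inABlock_of_mem_blockStarts {n : ℕ} {e : Fin n → ℕ} {i : Fin n}
    (h : i ∈ blockStarts e) : ¬ InABlock e i := by
  rcases mem_blockStarts.1 h with h | h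
  · exact h.not_inABlock
  · exact h.1

theorem eq_of_not_inABlock {n : ℕ} {e : Fin n → ℕ} {i j : Fin n} (h : ¬ InABlock e i)
    (hij : e j = e i) : j = i :=
  by_contra fun hne => h ⟨j, hne, hij⟩

/-- Consecutive values that each occur once sit at adjacent positions of a monotone tuple, so they
form a candidate pair. The greedy rule then either starts a b-block at i or has already used i as a
second entry. -/
theorem blockStarts_ne_add_one {n : ℕ} {e : Fin n → ℕ} (he : Monotone e) {i j : Fin n}
    (hi : i ∈ blockStarts e) (hj : j ∈ blockStarts e) : e j ≠ e i + 1 := by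
  intro hij
  have hia := not_inABlock_of_mem_blockStarts hi
  have hja := not_inABlock_of_mem_blockStarts hj
  have hlt : i < j := by
    by_contra h
    have := he (not_lt.1 h)
    omega
  have hsucc : (i : ℕ) + 1 = j := by
    by_contra hne
    have hn : (i : ℕ) + 1 < n := by omega
    have h1 : e i ≤ e ⟨i + 1, hn⟩ := he (Fin.mk_le_mk.2 (Nat.le_succ i))
    have h2 : e ⟨i + 1, hn⟩ ≤ e j := he (Fin.le_def.2 (by simp; omega))
    rcases (by omega : e ⟨i + 1, hn⟩ = e i ∨ e ⟨i + 1, hn⟩ = e j) with h | h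
    · have := congrArg Fin.val (eq_of_not_inABlock hia h)
      simp at this
    · exact hne (congrArg Fin.val (eq_of_not_inABlock hja h))
  have hn : (i : ℕ) + 1 < n := by omega
  have hjj : j = ⟨i + 1, hn⟩ := Fin.ext hsucc.symm
  have hcand : IsCandidatePair e i := by
    subst hjj
    exact ⟨hn, hia, hja, hij⟩
  rcases mem_blockStarts.1 hi with h | h
  · rcases mem_blockStarts.1 hj with h' | h'
    · rw [← hsucc] at h'
      exact h.not_succ h'
    · exact h'.2 (Or.inr ⟨i, hsucc, h⟩)
  · apply h.2
    obtain ⟨i, hin⟩ := i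
    cases i with
    | zero => exact Or.inl hcand
    | succ i =>
      by_cases hs : StartsBBlock e i
      · exact Or.inr ⟨⟨i, by omega⟩, rfl, hs⟩
      · exact Or.inl ⟨hcand, hs⟩

/-- A labelling of the positions whose non-empty fibres are the blocks of `e`. -/
theorem exists_blockLabel {n : ℕ} (e : Fin n → ℕ) : ∃ β : Fin n → Fin n,
    (∀ i j : Fin n, (j : ℕ) + 1 = i → StartsBBlock e j → β i = j) ∧
    (∀ i : Fin n, (¬ ∃ j : Fin n, (j : ℕ) + 1 = i ∧ StartsBBlock e j) →
      β i = Set.rangeSplitting e ⟨e i, Set.mem_range_self i⟩) := by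
  classical
  -- The second entry of a b-block takes the position of the first as label; any other entry takes a
  -- chosen position with the same value, which is its own position when the value is unique.
  refine ⟨fun i => if h : ∃ j : Fin n, (j : ℕ) + 1 = i ∧ StartsBBlock e j then h.choose
    else Set.rangeSplitting e ⟨e i, Set.mem_range_self i⟩, fun i j hij hj => ?_, fun i hi => dif_neg hi⟩
  have h : ∃ j : Fin n, (j : ℕ) + 1 = i ∧ StartsBBlock e j := ⟨j, hij, hj⟩
  have := h.choose_spec.1
  exact (dif_pos h).trans (Fin.ext (by omega))

/-! ### Realizing every exponent, and the main theorem. -/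

theorem attains_of_le {n : ℕ} (e : Fin n → ℕ) (he : ∀ i, 1 ≤ e i) {t : ℕ}
    (h1 : bCount e + cCount e ≤ t) (h2 : t ≤ total e) : Attains (∀ i, ZMod (2 ^ e i)) t := by
  obtain ⟨β, hβ1, hβ2⟩ := exists_blockLabel e
  have hrep : ∀ i, e (Set.rangeSplitting e ⟨e i, Set.mem_range_self i⟩) = e i :=
    fun i => Set.apply_rangeSplitting e ⟨e i, Set.mem_range_self i⟩
  have hβ : ∀ i k : Fin n, β i = k → ((k : ℕ) + 1 = i ∧ StartsBBlock e k) ∨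
      (¬ ∃ j : Fin n, (j : ℕ) + 1 = i ∧ StartsBBlock e j) ∧ e i = e k := by
    rintro i k rfl
    by_cases h : ∃ j : Fin n, (j : ℕ) + 1 = i ∧ StartsBBlock e j
    · obtain ⟨j, hj1, hj2⟩ := h
      rw [hβ1 i j hj1 hj2]
      exact Or.inl ⟨hj1, hj2⟩
    · refine Or.inr ⟨h, ?_⟩
      rw [hβ2 i h, hrep]
  have hβself : ∀ i, ¬ InABlock e i → (¬ ∃ j : Fin n, (j : ℕ) + 1 = i ∧ StartsBBlock e j) →
      β i = i := by
    intro i hia hi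
    rw [hβ2 i hi]
    exact eq_of_not_inABlock hia (hrep i)
  -- The lower ends are 1 on labels of b- and c-blocks and 0 elsewhere, so they sum to b(e) + c(e).
  -- Labels with empty fibre only need exponent 0.
  refine attains_pi_of_fibers e β (fun k => if k ∈ blockStarts e then 1 else 0) (fun k => ?_)
    (by simpa [card_blockStarts] using h1) h2
  have hempty : k ∉ blockStarts e → IsEmpty {i // β i = k} → _ := fun hk hE =>
    (show (if k ∈ blockStarts e then 1 else 0) ≤ ∑ i : {i // β i = k}, e i ∧
      ∀ t, (if k ∈ blockStarts e then 1 else 0) ≤ t → t ≤ ∑ i : {i // β i = k}, e i →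
        Attains (∀ i : {i // β i = k}, ZMod (2 ^ e i)) t by
      rw [if_neg hk, Fintype.sum_empty]
      refine ⟨le_rfl, fun t _ ht => ?_⟩
      obtain rfl := Nat.le_zero.1 ht
      exact attains_pi_empty fun i : {i // β i = k} => e i)
  by_cases hka : InABlock e k
  · have hkS : k ∉ blockStarts e := fun h => not_inABlock_of_mem_blockStarts h hka
    have hfib : ∀ i, β i = k → e i = e k := fun i hi =>
      (hβ i k hi).elim (fun h => absurd hka h.2.not_inABlock) fun h => h.2
    have hsec : ∀ i, e i = e k → ¬ ∃ j : Fin n, (j : ℕ) + 1 = i ∧ StartsBBlock e j := by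
      rintro i hik ⟨j, hj1, hj2⟩
      obtain rfl := eq_of_not_inABlock (hj2.not_inABlock_succ hj1) hik.symm
      exact hj2.not_inABlock_succ hj1 hka
    have hcong : ∀ i, e i = e k → β i = β k := by
      intro i hik
      rw [hβ2 i (hsec i hik), hβ2 k (hsec k rfl)]
      congr 2
    by_cases hkk : β k = k
    · rw [if_neg hkS]
      refine ⟨Nat.zero_le _, fun t _ ht => ?_⟩
      obtain ⟨j, hjk, hj⟩ := hka
      have hsum : ∑ i : {i // β i = k}, e i = Fintype.card {i // β i = k} * e k := by
        rw [Finset.sum_congr rfl fun (i : {i // β i = k}) _ => hfib i i.2]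
        simp
      refine attains_pi_const (fun i : {i // β i = k} => e i) (he k) (fun i => hfib i i.2) ?_
        (hsum ▸ ht)
      exact Fintype.one_lt_card_iff.2 ⟨⟨j, (hcong j hj).trans hkk⟩, ⟨k, hkk⟩,
        fun h => hjk (congrArg Subtype.val h)⟩
    -- Another position represents the a-block of k, so the label k is unused.
    · exact hempty hkS ⟨fun i => hkk ((hcong i (hfib i i.2)).symm.trans i.2)⟩
  · by_cases hk2 : ∃ j : Fin n, (j : ℕ) + 1 = k ∧ StartsBBlock e j
    · obtain ⟨j, hj1, hj2⟩ := hk2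
      have hks : ¬ StartsBBlock e k := by
        rw [← hj1]
        exact hj2.not_succ
      refine hempty (fun h => ?_) ⟨fun i => ?_⟩
      · rcases mem_blockStarts.1 h with h | h
        · exact hks h
        · exact h.2 (Or.inr ⟨j, hj1, hj2⟩)
      · rcases hβ i k i.2 with h | h
        · exact hks h.2
        · have := eq_of_not_inABlock hka h.2
          exact h.1 ⟨j, by rw [this]; exact hj1, hj2⟩
    · have hkk := hβself k hka hk2
      by_cases hks : StartsBBlock e k
      · obtain ⟨hn, -⟩ := hks.isCandidatePair
        let k' : Fin n := ⟨k + 1, hn⟩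
        have hk' : β k' = k := hβ1 k' k rfl hks
        have he' : e k' = e k + 1 := hks.apply_succ rfl
        have hne : (⟨k, hkk⟩ : {i // β i = k}) ≠ ⟨k', hk'⟩ := fun h => by
          have := congrArg (fun i : {i // β i = k} => (i.1 : ℕ)) h
          simp [k'] at this
        have hall : ∀ i : {i // β i = k}, i = ⟨k, hkk⟩ ∨ i = ⟨k', hk'⟩ := by
          rintro ⟨i, hi⟩
          rcases hβ i k hi with h | h
          · exact Or.inr (Subtype.ext (Fin.ext h.1.symm))
          · exact Or.inl (Subtype.ext (eq_of_not_inABlock hka h.2))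
        have hsum : ∑ i : {i // β i = k}, e i = e k + e k' :=
          Fintype.sum_eq_add (f := fun i : {i // β i = k} => e i) _ _ hne
            fun i hi => absurd (hall i) (by tauto)
        have hk1 := he k
        rw [if_pos (mem_blockStarts.2 (Or.inl hks)), hsum]
        refine ⟨by omega, fun t ht1 ht2 => ?_⟩
        refine attains_pi_pair (fun i : {i // β i = k} => e i) _ _ hne hall ?_
        rcases Nat.eq_or_lt_of_le ht1 with rfl | ht1
        · have := attains_one_of_succ (e k)
          rw [← he'] at this
          exact this
        · exact attains_prod_of_two_le (he k) (he k') ht1 ht2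
      · have hall : ∀ i : {i // β i = k}, i = ⟨k, hkk⟩ := by
          rintro ⟨i, hi⟩
          rcases hβ i k hi with h | h
          · exact absurd h.2 hks
          · exact Subtype.ext (eq_of_not_inABlock hka h.2)
        have hsum : ∑ i : {i // β i = k}, e i = e k :=
          Fintype.sum_eq_single (f := fun i : {i // β i = k} => e i) ⟨k, hkk⟩
            fun i hi => absurd (hall i) hi
        rw [if_pos (mem_blockStarts.2 (Or.inr ⟨hka, fun h => h.elim hks hk2⟩)), hsum]
        exact ⟨he k, fun t ht1 ht2 => attains_pi_unique (fun i : {i // β i = k} => e i) _ hall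
          (attains_zmod ht1 ht2)⟩

end Reidemeister

theorem mainTheorem3 {n : ℕ} (e : Fin n → ℕ) (he : Reidemeister.MemE e)
    (P : Type*) [AddCommGroup P] (hP : Reidemeister.HasType 2 e P) :
    Reidemeister.reidemeisterSpectrum P =
      {r : ℕ∞ | ∃ i : ℕ, Reidemeister.bCount e + Reidemeister.cCount e ≤ i ∧
        i ≤ Reidemeister.total e ∧ r = 2 ^ i} := by
  obtain ⟨f⟩ := hP
  have : Finite P := Finite.of_equiv _ f.symm.toEquiv
  ext r
  constructor
  · rintro ⟨ψ, rfl⟩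
    rw [Reidemeister.reidemeisterNumber_eq_card_fixedPoints,
      ← Reidemeister.card_fixedPoints_congr f ψ]
    have hle := Reidemeister.two_pow_card_le_card_fixedPoints e he.1 (Reidemeister.blockStarts e)
      (fun s hs j => Reidemeister.eq_of_not_inABlock
        (Reidemeister.not_inABlock_of_mem_blockStarts hs))
      (fun s hs s' hs' => Reidemeister.blockStarts_ne_add_one he.2 hs hs')
      ((f.symm.trans ψ).trans f)
    have hdvd := AddSubgroup.card_addSubgroup_dvd_card
      (Reidemeister.fixedPoints ((f.symm.trans ψ).trans f))
    have hcard : Nat.card (∀ i, ZMod (2 ^ e i)) = 2 ^ Reidemeister.total e := by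
      rw [Nat.card_pi, Reidemeister.total, ← Finset.prod_pow_eq_pow_sum]
      simp
    rw [hcard, Nat.dvd_prime_pow Nat.prime_two] at hdvd
    obtain ⟨i, hi, hcardi⟩ := hdvd
    rw [hcardi, Reidemeister.card_blockStarts,
      Nat.pow_le_pow_iff_right (by norm_num)] at hle
    exact ⟨i, hle, hi, by rw [hcardi]; push_cast; rfl⟩
  · rintro ⟨i, h1, h2, rfl⟩
    obtain ⟨ψ, hψ⟩ := (Reidemeister.attains_of_le e he.1 h1 h2).congr f.symm
    refine ⟨ψ, ?_⟩
    rw [Reidemeister.reidemeisterNumber_eq_card_fixedPoints, hψ]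
    push_cast
    rfl
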